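/- Let $\mathcal Y$ be a finite set, let $P_{\mathrm{human}}$ and $P_{\mathrm{model}}$ be probability distributions on $\mathcal Y$, and let $y_1,\dots,y_n$ ($n\ge 1$) be i.i.d. samples from $P_{\mathrm{model}}$, with empirical distribution $\widehat P(y)=\frac1n\,\#\{i : y_i=y\}$. Let $y^*_{\mathrm{MAP}}\in\arg\max_{y\in\mathcal Y}P_{\mathrm{human}}(y)$ and let $\hat y_{\mathrm{MAP}}\in\arg\max_{y\in\{y_1,\dots,y_n\}}\widehat P(y)$ be a Monte Carlo MAP output, with ties broken in an arbitrary (measurable) way. Let $C:\mathcal Y\times\mathcal Y\to\mathbb R$ be a cost function for which the utility of MAP decoding, the indicator $u(y,y')=\mathbb I(y=y')$, is smooth, i.e. $|u(y,y')-u(y,y'')|\le C(y',y'')$ for all $y,y',y''\in\mathcal Y$, and let $$\mathrm{WD}(P_{\mathrm{human}},P_{\mathrm{model}})=\inf_{\gamma}\sum_{i,j\in\mathcal Y}\gamma_{ij}\,C(i,j),$$ where $\gamma$ ranges over all joint distributions on $\mathcal Y\times\mathcal Y$ with first marginal $P_{\mathrm{human}}$ and second marginal $P_{\mathrm{model}}$.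 Then for every $\delta\in(0,1)$, with probability at least $1-\delta$, $$P_{\mathrm{human}}(y^*_{\mathrm{MAP}})-P_{\mathrm{human}}(\hat y_{\mathrm{MAP}})\;\le\;6\sqrt{\frac1n\log\frac1\delta}+2\,\mathrm{WD}(P_{\mathrm{human}},P_{\mathrm{model}}).$$ -/

import Mathlib

open MeasureTheory ProbabilityTheory

noncomputable section

namespace MAPDecoding

variable {Y : Type*}

/-- The probability mass `P(y)` as a real number. -/
def mass (P : PMF Y) (y : Y) : ℝ := (P y).toReal

/-- The indicator utility `u(y, y') = 𝕀(y = y')`. The expected utility of `y` under `P` is then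
`∑ y', u(y, y') P(y') = P(y)`, so that decoding with this utility is MAP decoding. -/
def indicatorUtility [DecidableEq Y] (y y' : Y) : ℝ := if y = y' then 1 else 0

/-- Smoothness of the utility `u` with respect to the cost `C`:
`|u(y, y') - u(y, y'')| ≤ C(y', y'')` for all `y, y', y''`. -/
def UtilitySmooth (u C : Y → Y → ℝ) : Prop :=
  ∀ y y' y'' : Y, |u y y' - u y y''| ≤ C y' y''

/-- `γ` is a joint distribution with marginals `ν` (first) and `μ` (second). -/
structure IsCoupling [Fintype Y] (ν μ : PMF Y) (γ : Y → Y → ℝ) : Prop where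
  nonneg : ∀ i j, 0 ≤ γ i j
  marginal_fst : ∀ i, ∑ j, γ i j = mass ν i
  marginal_snd : ∀ j, ∑ i, γ i j = mass μ j

/-- The Wasserstein distance `inf_γ ∑ γ i j * C i j` over all couplings `γ` of `ν` and `μ`. -/
def WD [Fintype Y] (C : Y → Y → ℝ) (ν μ : PMF Y) : ℝ :=
  sInf {c : ℝ | ∃ γ : Y → Y → ℝ, IsCoupling ν μ γ ∧ c = ∑ i, ∑ j, γ i j * C i j}

/-- `y` is a mode of `P`, that is `y ∈ argmax P`. -/
def IsMAP (P : PMF Y) (y : Y) : Prop := ∀ y', mass P y' ≤ mass P y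

/-- The empirical distribution `P̂(y) = #{i | s i = y} / n` of a sample `s` of size `n`
(counted with multiplicity). -/
def empirical [DecidableEq Y] {n : ℕ} (s : Fin n → Y) (y : Y) : ℝ :=
  (∑ i, indicatorUtility y (s i)) / (n : ℝ)

/-- `y` is a Monte Carlo MAP output for the sample `s`: it is one of the sampled hypotheses and
maximizes the empirical distribution among them (ties may be broken in any way). -/
def IsMonteCarloMAP [DecidableEq Y] {n : ℕ} (s : Fin n → Y) (y : Y) : Prop :=
  (∃ i, s i = y) ∧ ∀ i, empirical s (s i) ≤ empirical s y

/-- The MAP regret `P(y*) - P(ŷ)`. -/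
def mapRegret (P : PMF Y) (yStar yHat : Y) : ℝ := mass P yStar - mass P yHat

end MAPDecoding

end

/-! Testing the indicator utility against any coupling shows that the two distributions differ at
each point by at most `WD`, so replacing `Phuman` by `Pmodel` at the two outputs costs `2 * WD`.
What remains concerns one distribution `p`: writing `δ = exp (-L)`, with probability at least `1 -
δ` every `b` at least as frequent as `a` satisfies `p a - p b ≤ t`, where `t = 6 √(L / n)`. This is
uniform in `b`, so tie-breaking is irrelevant.

For `L ≥ 1/10`, McDiarmid is applied to the Euclidean norm of the count deviations. Its mean is at
most `√n` whatever the size of `Y`, and this mean is absorbed into the constant 6.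

For smaller `L` the mean dominates and concentration says nothing, but a success probability of `L =
n t² / 36` suffices, since `1 - exp (-L) ≤ L`. `le_sampleProb_ahead` obtains it from two devices.
Exchanging `a` with the leading `b` compares samples where `b` leads with samples where `a` does
(`sampleProb_ahead_le`). Writing `p = (1 - r) p' + r δ_a` and recolouring entries to `a` turns
"level, or only slightly behind" into "strictly ahead" (`mul_sampleProb_le_sampleProb_ahead`). -/

namespace MAPDecoding

/-! ### Finite product probabilities and the exchange argument. -/

section SampleProbability

variable {Y : Type*} {n : ℕ}

/-- The number of occurrences of `y` in the sample `x`. -/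
def occ [DecidableEq Y] (x : Fin n → Y) (y : Y) : ℕ := (Finset.univ.filter fun i => x i = y).card

lemma occ_comp_swap [DecidableEq Y] (x : Fin n → Y) (a b y : Y) :
    occ (fun i => Equiv.swap a b (x i)) y = occ x (Equiv.swap a b y) := by
  unfold occ
  congr 1
  ext i
  simp only [Finset.mem_filter, Finset.mem_univ, true_and]
  exact Equiv.swap_apply_eq_iff

variable [Fintype Y]

open Classical in
/-- The probability of the event `S` when the coordinates of `x : Fin n → Y` are drawn
independently with mass function `p`. -/
noncomputable def sampleProb (p : Y → ℝ) (S : (Fin n → Y) → Prop) : ℝ :=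
  ∑ x : Fin n → Y, if S x then ∏ i, p (x i) else 0

lemma sum_prod_eq_one {ι : Type*} [Fintype ι] {p : ι → ℝ} (h1 : ∑ y, p y = 1) :
    ∑ x : Fin n → ι, ∏ i, p (x i) = 1 := by
  classical
  have := (Finset.prod_univ_sum (fun _ : Fin n => (Finset.univ : Finset ι)) (fun _ y => p y)).symm
  rw [Fintype.piFinset_univ] at this
  rw [this]
  simp [h1]

lemma sampleProb_nonneg {p : Y → ℝ} (h0 : ∀ y, 0 ≤ p y) (S : (Fin n → Y) → Prop) :
    0 ≤ sampleProb p S := by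
  classical
  unfold sampleProb
  refine Finset.sum_nonneg fun x _ => ?_
  split_ifs
  · exact Finset.prod_nonneg fun i _ => h0 _
  · exact le_rfl

lemma sampleProb_mono {p : Y → ℝ} (h0 : ∀ y, 0 ≤ p y) {S T : (Fin n → Y) → Prop}
    (h : ∀ x, S x → T x) : sampleProb p S ≤ sampleProb p T := by
  classical
  unfold sampleProb
  refine Finset.sum_le_sum fun x _ => ?_
  have hw : 0 ≤ ∏ i, p (x i) := Finset.prod_nonneg fun i _ => h0 _
  by_cases hS : S x
  · simp [hS, h x hS]
  · rw [if_neg hS]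
    split_ifs
    · exact hw
    · exact le_rfl

lemma sampleProb_add_not {p : Y → ℝ} (h1 : ∑ y, p y = 1) (S : (Fin n → Y) → Prop) :
    sampleProb p S + sampleProb p (fun x => ¬ S x) = 1 := by
  classical
  unfold sampleProb
  rw [← Finset.sum_add_distrib, ← sum_prod_eq_one (n := n) h1]
  refine Finset.sum_congr rfl fun x _ => ?_
  by_cases hS : S x <;> simp [hS]

lemma sampleProb_eq_one {p : Y → ℝ} (h1 : ∑ y, p y = 1) {S : (Fin n → Y) → Prop}
    (h : ∀ x, S x) : sampleProb p S = 1 := by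
  classical
  simp only [sampleProb, h, if_true]
  exact sum_prod_eq_one h1

lemma sampleProb_exists_le {p : Y → ℝ} (h0 : ∀ y, 0 ≤ p y) (B : Finset Y)
    (S : Y → (Fin n → Y) → Prop) :
    sampleProb p (fun x => ∃ b ∈ B, S b x) ≤ ∑ b ∈ B, sampleProb p (S b) := by
  classical
  unfold sampleProb
  rw [Finset.sum_comm]
  refine Finset.sum_le_sum fun x _ => ?_
  have hw : 0 ≤ ∏ i, p (x i) := Finset.prod_nonneg fun i _ => h0 _
  have hnn : ∀ b ∈ B, 0 ≤ if S b x then ∏ i, p (x i) else 0 := fun b _ => by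
    split_ifs
    · exact hw
    · exact le_rfl
  split_ifs with h
  · obtain ⟨b, hb, hS⟩ := h
    have := Finset.single_le_sum hnn hb
    rwa [if_pos hS] at this
  · exact Finset.sum_nonneg hnn

variable [DecidableEq Y]

lemma prod_comp_eq_prod_pow_occ (f : Y → ℝ) (x : Fin n → Y) :
    ∏ i, f (x i) = ∏ y, f y ^ occ x y := by
  classical
  rw [Finset.prod_comp f x]
  refine Finset.prod_subset (Finset.subset_univ _) fun y _ hy => ?_
  have : (Finset.univ.filter fun i => x i = y) = ∅ := by
    ext i
    simp only [Finset.mem_filter, Finset.mem_univ, true_and, Finset.notMem_empty, iff_false]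
    exact fun h => hy (Finset.mem_image.2 ⟨i, Finset.mem_univ _, h⟩)
  simp [this]

/-- Exchanging the roles of `a` and a more frequent but less likely `b` in a sample makes the sample
more likely. -/
lemma mul_prod_le_mul_prod_swap {p : Y → ℝ} (h0 : ∀ y, 0 ≤ p y) {a b : Y} (hab : a ≠ b) {ρ : ℝ}
    (hρ : 0 ≤ ρ) (hpb : p b ≤ ρ * p a) (hle : p b ≤ p a) {k : ℕ} {x : Fin n → Y}
    (hx : occ x a + k + 1 ≤ occ x b) :
    p a * ∏ i, p (x i) ≤ ρ ^ k * p b * ∏ i, p (Equiv.swap a b (x i)) := by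
  classical
  rw [prod_comp_eq_prod_pow_occ p x, prod_comp_eq_prod_pow_occ (fun y => p (Equiv.swap a b y)) x]
  have hb : b ∈ Finset.univ.erase a := by simp [hab.symm]
  rw [← Finset.mul_prod_erase _ _ (Finset.mem_univ a), ← Finset.mul_prod_erase _ _ hb,
    ← Finset.mul_prod_erase _ _ (Finset.mem_univ a), ← Finset.mul_prod_erase _ _ hb]
  have hR : ∏ y ∈ (Finset.univ.erase a).erase b, p (Equiv.swap a b y) ^ occ x y
      = ∏ y ∈ (Finset.univ.erase a).erase b, p y ^ occ x y := by
    refine Finset.prod_congr rfl fun y hy => ?_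
    simp only [Finset.mem_erase, Finset.mem_univ, and_true] at hy
    rw [Equiv.swap_apply_of_ne_of_ne hy.2 hy.1]
  rw [hR, Equiv.swap_apply_left, Equiv.swap_apply_right]
  have hR0 : 0 ≤ ∏ y ∈ (Finset.univ.erase a).erase b, p y ^ occ x y :=
    Finset.prod_nonneg fun y _ => pow_nonneg (h0 y) _
  generalize ∏ y ∈ (Finset.univ.erase a).erase b, p y ^ occ x y = R at *
  obtain ⟨e, he⟩ := Nat.exists_eq_add_of_le hx
  rw [he]
  generalize occ x a = j
  have h1 : p b ^ k ≤ ρ ^ k * p a ^ k := by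
    rw [← mul_pow]
    exact pow_le_pow_left₀ (h0 b) hpb k
  have h2 : p b ^ e ≤ p a ^ e := pow_le_pow_left₀ (h0 b) hle e
  have h3 : p b ^ k * p b ^ e ≤ ρ ^ k * p a ^ k * p a ^ e :=
    mul_le_mul h1 h2 (pow_nonneg (h0 b) _)
      (mul_nonneg (pow_nonneg hρ _) (pow_nonneg (h0 a) _))
  have h4 : 0 ≤ p a * p a ^ j * p b ^ j * p b * R := by
    have := h0 a
    have := h0 b
    positivity
  calc p a * (p a ^ j * (p b ^ (j + k + 1 + e) * R))
      = (p a * p a ^ j * p b ^ j * p b * R) * (p b ^ k * p b ^ e) := by ring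
    _ ≤ (p a * p a ^ j * p b ^ j * p b * R) * (ρ ^ k * p a ^ k * p a ^ e) :=
        mul_le_mul_of_nonneg_left h3 h4
    _ = ρ ^ k * p b * (p b ^ j * (p a ^ (j + k + 1 + e) * R)) := by ring

/-- If every `b ∈ B` is less likely than `a` by a factor `ρ`, then it is unlikely that some `b ∈ B`
is ahead of `a` by more than `k`, compared to `a` being level with or ahead of all of `B`. -/
lemma sampleProb_ahead_le {p : Y → ℝ} (h0 : ∀ y, 0 ≤ p y) (h1 : ∑ y, p y = 1) {a : Y}
    {B : Finset Y} (haB : a ∉ B) {ρ : ℝ} (hρ : 0 ≤ ρ) (hρ1 : ρ ≤ 1)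
    (hB : ∀ b ∈ B, p b ≤ ρ * p a) (k : ℕ) :
    p a * sampleProb p (fun x : Fin n → Y => ∃ b ∈ B, occ x a + k + 1 ≤ occ x b)
      ≤ ρ ^ k * (1 - p a) * sampleProb p (fun x : Fin n → Y => ∀ b ∈ B, occ x b ≤ occ x a) := by
  classical
  set T := sampleProb p (fun x : Fin n → Y => ∀ b ∈ B, occ x b ≤ occ x a) with hT
  have hT0 : 0 ≤ T := sampleProb_nonneg h0 _
  -- Requiring `b` to lead all of `B` ensures that after the exchange `a` is level with or ahead of
  -- all of `B`.
  let E : Y → (Fin n → Y) → Prop := fun b x =>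
    occ x a + k + 1 ≤ occ x b ∧ ∀ c ∈ B, occ x c ≤ occ x b
  have hE : sampleProb p (fun x : Fin n → Y => ∃ b ∈ B, occ x a + k + 1 ≤ occ x b)
      ≤ ∑ b ∈ B, sampleProb p (E b) := by
    refine le_trans (sampleProb_mono h0 ?_) (sampleProb_exists_le h0 B E)
    rintro x ⟨b, hb, hx⟩
    obtain ⟨c, hc, hmax⟩ := Finset.exists_max_image B (occ x) ⟨b, hb⟩
    exact ⟨c, hc, hx.trans (hmax b hb), hmax⟩
  have hEb : ∀ b ∈ B, p a * sampleProb p (E b) ≤ ρ ^ k * p b * T := by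
    intro b hb
    have hab : a ≠ b := fun h => haB (h ▸ hb)
    have hle : p b ≤ p a := (hB b hb).trans (mul_le_of_le_one_left (h0 a) hρ1)
    have hT' : T = ∑ x : Fin n → Y,
        if ∀ c ∈ B, occ (fun i => Equiv.swap a b (x i)) c ≤ occ (fun i => Equiv.swap a b (x i)) a
          then ∏ i, p (Equiv.swap a b (x i)) else 0 := by
      rw [hT, sampleProb]
      rw [← Equiv.sum_comp (Equiv.arrowCongr (Equiv.refl (Fin n)) (Equiv.swap a b))]
      refine Finset.sum_congr rfl fun x _ => ?_
      simp only [Equiv.arrowCongr, Equiv.coe_fn_mk, Function.comp_def, Equiv.refl_symm,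
        Equiv.refl_apply]
      congr
    rw [hT', sampleProb, Finset.mul_sum, Finset.mul_sum]
    refine Finset.sum_le_sum fun x _ => ?_
    have hw : 0 ≤ ∏ i, p (Equiv.swap a b (x i)) := Finset.prod_nonneg fun i _ => h0 _
    have hρk : 0 ≤ ρ ^ k * p b := mul_nonneg (pow_nonneg hρ _) (h0 b)
    by_cases hx : E b x
    · have hc : ∀ c ∈ B, occ (fun i => Equiv.swap a b (x i)) c
          ≤ occ (fun i => Equiv.swap a b (x i)) a := by
        intro c hc
        rw [occ_comp_swap, occ_comp_swap, Equiv.swap_apply_left]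
        by_cases hcb : c = b
        · rw [hcb, Equiv.swap_apply_right]
          have := hx.1
          omega
        · rw [Equiv.swap_apply_of_ne_of_ne (fun h : c = a => haB (h ▸ hc)) hcb]
          exact hx.2 c hc
      rw [if_pos hx, if_pos hc]
      exact mul_prod_le_mul_prod_swap h0 hab hρ (hB b hb) hle hx.1
    · rw [if_neg hx, mul_zero]
      split_ifs
      · exact mul_nonneg hρk hw
      · simp
  -- A lead of `k + 1` gains `k + 1` likelihood ratios: `k` of them give `ρ ^ k`, and the last is
  -- kept as `p b / p a` so that the union bound sums to at most `1 - p a`, with no factor `B.card`.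
  have hsum : ∑ b ∈ B, p b ≤ 1 - p a := by
    have : ∑ b ∈ insert a B, p b ≤ ∑ y, p y :=
      Finset.sum_le_sum_of_subset_of_nonneg (Finset.subset_univ _) fun y _ _ => h0 y
    rw [Finset.sum_insert haB, h1] at this
    linarith
  calc p a * sampleProb p (fun x : Fin n → Y => ∃ b ∈ B, occ x a + k + 1 ≤ occ x b)
      ≤ p a * ∑ b ∈ B, sampleProb p (E b) := mul_le_mul_of_nonneg_left hE (h0 a)
    _ = ∑ b ∈ B, p a * sampleProb p (E b) := Finset.mul_sum _ _ _
    _ ≤ ∑ b ∈ B, ρ ^ k * p b * T := Finset.sum_le_sum hEb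
    _ = ρ ^ k * (∑ b ∈ B, p b) * T := by
        rw [Finset.mul_sum, Finset.sum_mul]
    _ ≤ ρ ^ k * (1 - p a) * T :=
        mul_le_mul_of_nonneg_right (mul_le_mul_of_nonneg_left hsum (pow_nonneg hρ _)) hT0

end SampleProbability

/-! ### Recolouring entries to `a`, and the regime of small `L`. -/

section Recolouring

variable {Y : Type*} {n : ℕ}

/-- The sample obtained from `x` by replacing the entries marked by `ε` with `a`. -/
def recolour (a : Y) (ε : Fin n → Bool) (x : Fin n → Y) : Fin n → Y :=
  fun i => if ε i then a else x i

/-- The mass function of a Bernoulli variable with success probability `r`. -/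
def bernoulliMass (r : ℝ) (e : Bool) : ℝ := if e then r else 1 - r

lemma sum_bernoulliMass (r : ℝ) : ∑ e, bernoulliMass r e = 1 := by
  simp [bernoulliMass]

lemma bernoulliMass_nonneg {r : ℝ} (hr : 0 ≤ r) (hr1 : r ≤ 1) (e : Bool) :
    0 ≤ bernoulliMass r e := by
  cases e <;> simp [bernoulliMass] <;> linarith

/-- A lower bound in product form for the number of successes in `J`. -/
lemma pow_mul_sampleProb_card_le {r θ : ℝ} (hr : 0 ≤ r) (hr1 : r ≤ 1) (hθ : 0 ≤ θ) (hθ1 : θ ≤ 1)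
    (J : Finset (Fin n)) (k : ℕ) :
    θ ^ k * sampleProb (bernoulliMass r) (fun ε : Fin n → Bool => (J.filter fun i => ε i).card ≤ k)
      ≤ (1 - r * (1 - θ)) ^ J.card := by
  classical
  -- Chernoff: the expectation of `θ ^ (successes in J)` factorises, and it dominates `θ ^ k` times
  -- the probability of at most `k` successes.
  have key : ∑ ε : Fin n → Bool, ∏ i, (bernoulliMass r (ε i) * if i ∈ J ∧ ε i then θ else 1)
      = (1 - r * (1 - θ)) ^ J.card := by
    have h := (Finset.prod_univ_sum (fun _ : Fin n => (Finset.univ : Finset Bool))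
      (fun i e => bernoulliMass r e * if i ∈ J ∧ e then θ else 1)).symm
    rw [Fintype.piFinset_univ] at h
    rw [h, ← Finset.prod_const, ← Finset.prod_subset (Finset.subset_univ J)]
    · refine Finset.prod_congr rfl fun i hi => ?_
      simp [bernoulliMass, hi]
      ring
    · intro i _ hi
      simp [bernoulliMass, hi]
  rw [← key, sampleProb, Finset.mul_sum]
  refine Finset.sum_le_sum fun ε _ => ?_
  rw [Finset.prod_mul_distrib]
  have hw : 0 ≤ ∏ i, bernoulliMass r (ε i) :=
    Finset.prod_nonneg fun i _ => bernoulliMass_nonneg hr hr1 _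
  have hθp : ∏ i, (if i ∈ J ∧ ε i then θ else 1) = θ ^ (J.filter fun i => ε i).card := by
    rw [← Finset.prod_const, ← Finset.prod_filter]
    refine Finset.prod_congr ?_ fun _ _ => rfl
    ext i
    simp
  rw [hθp]
  split_ifs with h
  · rw [mul_comm]
    exact mul_le_mul_of_nonneg_left (pow_le_pow_of_le_one hθ hθ1 h) hw
  · rw [mul_zero]
    exact mul_nonneg hw (pow_nonneg hθ _)

/-- Change of variables for product laws: `p` is the image of `q` under `g`. It is used with `Z =
Bool × Y`, the recolouring mark and the original entry. -/
lemma sum_prod_mul_comp {Z : Type*} [Fintype Z] [Fintype Y] [DecidableEq Y] (g : Z → Y)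
    (q : Z → ℝ) (p : Y → ℝ) (hp : ∀ y, p y = ∑ z, if g z = y then q z else 0)
    (F : (Fin n → Y) → ℝ) :
    ∑ x : Fin n → Y, (∏ i, p (x i)) * F x
      = ∑ z : Fin n → Z, (∏ i, q (z i)) * F (fun i => g (z i)) := by
  classical
  have h : ∀ x : Fin n → Y, ∏ i, p (x i)
      = ∑ z : Fin n → Z, if (fun i => g (z i)) = x then ∏ i, q (z i) else 0 := by
    intro x
    simp only [hp]
    rw [Finset.prod_univ_sum, Fintype.piFinset_univ]
    refine Finset.sum_congr rfl fun z _ => ?_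
    split_ifs with hz
    · refine Finset.prod_congr rfl fun i _ => ?_
      rw [if_pos (congrFun hz i)]
    · obtain ⟨i, hi⟩ := Function.ne_iff.1 hz
      exact Finset.prod_eq_zero (Finset.mem_univ i) (if_neg hi)
  simp only [h, Finset.sum_mul]
  rw [Finset.sum_comm]
  refine Finset.sum_congr rfl fun z _ => ?_
  simp only [ite_mul, zero_mul]
  simp

variable [DecidableEq Y]

lemma sum_occ (x : Fin n → Y) (a : Y) :
    occ x a + (Finset.univ.filter fun i => x i ≠ a).card = n := by
  unfold occ
  rw [Finset.card_filter_add_card_filter_not]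
  simp

lemma occ_add_occ_le (x : Fin n → Y) {a b : Y} (hab : a ≠ b) : occ x a + occ x b ≤ n := by
  refine le_trans (Nat.add_le_add_left (Finset.card_le_card fun i => ?_) _) (sum_occ x a).le
  simp only [Finset.mem_filter, Finset.mem_univ, true_and]
  rintro rfl
  exact hab.symm

lemma occ_recolour_self (a : Y) (ε : Fin n → Bool) (x : Fin n → Y) :
    occ (recolour a ε x) a
      = occ x a + ((Finset.univ.filter fun i => x i ≠ a).filter fun i => ε i).card := by
  unfold occ recolour
  rw [← Finset.card_union_of_disjoint]
  · congr 1
    ext i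
    simp only [Finset.mem_filter, Finset.mem_univ, true_and, Finset.mem_union]
    by_cases h : x i = a <;> simp [h]
  · rw [Finset.disjoint_left]
    intro i
    simp only [Finset.mem_filter, Finset.mem_univ, true_and]
    exact fun h h' => h'.1 h

lemma occ_recolour_le {a b : Y} (hab : a ≠ b) (ε : Fin n → Bool) (x : Fin n → Y) :
    occ (recolour a ε x) b ≤ occ x b := by
  refine Finset.card_le_card fun i => ?_
  simp only [Finset.mem_filter, Finset.mem_univ, true_and]
  unfold recolour
  by_cases h : ε i = true <;> simp [h, hab]

variable [Fintype Y]

/-- If `p = (1 - r) p' + r δ_a`, then an independent sample from `p` is a sample from `p'` each of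
whose entries is replaced with `a` with probability `r`. -/
lemma sampleProb_eq_sum_recolour {p p' : Y → ℝ} {r : ℝ} {a : Y}
    (hp : ∀ y, p y = (1 - r) * p' y + if a = y then r else 0) (h1' : ∑ y, p' y = 1)
    (S : (Fin n → Y) → Prop) :
    sampleProb p S = ∑ x : Fin n → Y, (∏ i, p' (x i)) *
      sampleProb (bernoulliMass r) (fun ε => S (recolour a ε x)) := by
  classical
  have hL : sampleProb p S = ∑ x : Fin n → Y, (∏ i, p (x i)) * if S x then 1 else 0 := by
    unfold sampleProb
    exact Finset.sum_congr rfl fun x _ => by simp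
  rw [hL, sum_prod_mul_comp (fun z : Bool × Y => if z.1 then a else z.2)
    (fun z => bernoulliMass r z.1 * p' z.2) p]
  · rw [← Equiv.sum_comp (Equiv.arrowProdEquivProdArrow (Fin n) (fun _ => Bool) (fun _ => Y)).symm,
      Fintype.sum_prod_type, Finset.sum_comm]
    refine Finset.sum_congr rfl fun x _ => ?_
    rw [sampleProb, Finset.mul_sum]
    refine Finset.sum_congr rfl fun ε _ => ?_
    simp only [Equiv.arrowProdEquivProdArrow, Equiv.coe_fn_symm_mk, Finset.prod_mul_distrib]
    change _ * (if S (recolour a ε x) then (1 : ℝ) else 0) = _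
    simp only [mul_ite, mul_one, mul_zero]
    congr 1
    ring
  · intro y
    rw [hp, Fintype.sum_prod_type]
    simp only [Fintype.sum_bool, bernoulliMass]
    by_cases hay : a = y
    · simp [hay, ← Finset.mul_sum, h1']
      ring
    · simp [hay]

/-- Passing from `p'` to `p = (1 - r) p' + r δ_a` turns samples in which no `b ∈ B` is ahead of `a`
by more than `k` into samples in which `a` is strictly ahead of `B`, up to probability `η`. -/
lemma mul_sampleProb_le_sampleProb_ahead {p p' : Y → ℝ} {r : ℝ} {a : Y} (hr : 0 ≤ r) (hr1 : r ≤ 1)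
    (hp : ∀ y, p y = (1 - r) * p' y + if a = y then r else 0) (h0' : ∀ y, 0 ≤ p' y)
    (h1' : ∑ y, p' y = 1) {B : Finset Y} (haB : a ∉ B) (k : ℕ) {θ η : ℝ} (hθ : 0 ≤ θ) (hθ1 : θ ≤ 1)
    (hθk : 0 < θ ^ k) (hη : 0 ≤ η) (hexp : Real.exp (-(r * (1 - θ) * (n / 2))) ≤ θ ^ k * η) :
    (1 - η) * sampleProb p' (fun x : Fin n → Y => ∀ b ∈ B, occ x b ≤ occ x a + k)
      ≤ sampleProb p (fun x : Fin n → Y => ∀ b ∈ B, occ x b < occ x a) := by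
  classical
  rw [sampleProb_eq_sum_recolour hp h1', sampleProb, Finset.mul_sum]
  refine Finset.sum_le_sum fun x _ => ?_
  have hw : 0 ≤ ∏ i, p' (x i) := Finset.prod_nonneg fun i _ => h0' _
  have hβ := bernoulliMass_nonneg hr hr1
  split_ifs with hx
  · rw [mul_comm]
    refine mul_le_mul_of_nonneg_left ?_ hw
    set J := Finset.univ.filter fun i => x i ≠ a with hJ
    have hcard : occ x a + J.card = n := sum_occ x a
    -- Either at least half of the entries can be recoloured, and more than `k` of them probably
    -- are, or `a` already holds a strict majority, which recolouring preserves.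
    by_cases hJn : n ≤ 2 * J.card
    · have hfew : θ ^ k * sampleProb (bernoulliMass r)
          (fun ε : Fin n → Bool => (J.filter fun i => ε i).card ≤ k) ≤ θ ^ k * η := by
        refine (pow_mul_sampleProb_card_le hr hr1 hθ hθ1 J k).trans (le_trans ?_ hexp)
        have hbase : 0 ≤ 1 - r * (1 - θ) := by nlinarith
        refine (pow_le_pow_left₀ hbase (Real.one_sub_le_exp_neg (r * (1 - θ))) _).trans ?_
        rw [← Real.exp_nat_mul]
        refine Real.exp_le_exp.2 ?_
        have h2 : (n : ℝ) / 2 ≤ J.card := by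
          have : (n : ℝ) ≤ 2 * J.card := by exact_mod_cast hJn
          linarith
        have h3 : 0 ≤ r * (1 - θ) := mul_nonneg hr (by linarith)
        nlinarith
      have hfew' := le_of_mul_le_mul_left hfew hθk
      have hadd := sampleProb_add_not (n := n) (sum_bernoulliMass r)
        (fun ε : Fin n → Bool => (J.filter fun i => ε i).card ≤ k)
      have hmono : sampleProb (bernoulliMass r)
          (fun ε : Fin n → Bool => ¬ (J.filter fun i => ε i).card ≤ k)
          ≤ sampleProb (bernoulliMass r)
            (fun ε => ∀ b ∈ B, occ (recolour a ε x) b < occ (recolour a ε x) a) := by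
        refine sampleProb_mono hβ fun ε hε b hb => ?_
        have hab : a ≠ b := fun h => haB (h ▸ hb)
        have e1 := occ_recolour_le hab ε x
        have e2 := occ_recolour_self a ε x
        have e3 := hx b hb
        rw [← hJ] at e2
        omega
      linarith
    · rw [sampleProb_eq_one (sum_bernoulliMass r)]
      · linarith
      · intro ε b hb
        have hab : a ≠ b := fun h => haB (h ▸ hb)
        have e1 := occ_recolour_le hab ε x
        have e2 := occ_recolour_self a ε x
        have e3 := occ_add_occ_le x hab
        omega
  · rw [mul_zero]
    exact mul_nonneg hw (sampleProb_nonneg hβ _)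

/-- Both `M - t / 2` and `(M - t / 2) * (t / 2 / (M - t))` are at least `t / 2`, so the right side
is at least `(k + 1) * t / 2`. -/
lemma mul_sq_div_le_mul_one_add {s t M M' k : ℝ} (ht : 0 < t) (htM : t < M) (hM : M - t / 2 ≤ M')
    (hk0 : 0 ≤ k) (hk : s * t / 8 ≤ k + 1) : s * t ^ 2 / 16 ≤ M' * (1 + k * (t / 2 / (M - t))) := by
  have hMt : 0 < M - t := by linarith
  have hv0 : 0 ≤ t / 2 / (M - t) := by positivity
  have f1 : t / 2 ≤ (M - t / 2) * (t / 2 / (M - t)) := by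
    rw [mul_div_assoc', le_div_iff₀ hMt]
    nlinarith
  have f2 : (M - t / 2) * (1 + k * (t / 2 / (M - t))) ≤ M' * (1 + k * (t / 2 / (M - t))) :=
    mul_le_mul_of_nonneg_right hM (by positivity)
  generalize t / 2 / (M - t) = v at *
  have f3 : k * (t / 2) ≤ k * ((M - t / 2) * v) := mul_le_mul_of_nonneg_left f1 hk0
  have f4 : s * t / 8 * (t / 2) ≤ (k + 1) * (t / 2) := mul_le_mul_of_nonneg_right hk (by linarith)
  linarith

set_option maxHeartbeats 1000000 in
/-- In a sample of size `n`, the outcome `a` is strictly ahead of all outcomes that are less likely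
by `t`, with probability of order at least `n t²`. -/
lemma le_sampleProb_ahead {p : Y → ℝ} (h0 : ∀ y, 0 ≤ p y) (h1 : ∑ y, p y = 1) {a : Y}
    {B : Finset Y} (hn : 0 < n) {t : ℝ} (ht : 0 < t) (hB : ∀ b ∈ B, p b < p a - t)
    (hnt : n * t ^ 2 ≤ 18 / 5) :
    n * t ^ 2 / 36 ≤ sampleProb p (fun x : Fin n → Y => ∀ b ∈ B, occ x b < occ x a) := by
  classical
  have hn0 : (0 : ℝ) < n := by exact_mod_cast hn
  rcases B.eq_empty_or_nonempty with rfl | ⟨b₀, hb₀⟩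
  · rw [sampleProb_eq_one h1 (by simp)]
    linarith
  have htM : t < p a := by linarith [hB b₀ hb₀, h0 b₀]
  have haB : a ∉ B := fun h => by linarith [hB a h]
  have hM1 : p a ≤ 1 := by
    rw [← h1]
    exact Finset.single_le_sum (fun y _ => h0 y) (Finset.mem_univ a)
  set M := p a with hM
  -- Half of the gap pays for recolouring; the other half keeps `a` likelier than `B` under `p'`, by
  -- the ratio `ρ`.
  set r := t / 2 with hr
  have hr0 : 0 < r := by positivity
  have hr2 : r < 1 / 2 := by rw [hr]; linarith
  have h1r : 0 < 1 - r := by linarith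
  set p' : Y → ℝ := fun y => (p y - if a = y then r else 0) / (1 - r) with hp'
  have hpp : ∀ y, p y = (1 - r) * p' y + if a = y then r else 0 := by
    intro y
    rw [hp']
    field_simp
    ring
  have h0' : ∀ y, 0 ≤ p' y := by
    intro y
    refine div_nonneg ?_ h1r.le
    split_ifs with h
    · rw [← h, ← hM]; linarith
    · simpa using h0 y
  have h1' : ∑ y, p' y = 1 := by
    rw [hp', ← Finset.sum_div, Finset.sum_sub_distrib, h1]
    simp [h1r.ne']
  have hM'eq : p' a = (M - r) / (1 - r) := by simp [hp', hM]
  have hM'le : M - r ≤ p' a := by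
    rw [hM'eq, le_div_iff₀ h1r]
    nlinarith
  have hMr : 0 < M - r := by rw [hr]; linarith
  have hMt : 0 < M - t := by linarith
  set ρ := (M - t) / (M - r) with hρ
  have hρ0 : 0 ≤ ρ := by positivity
  have hρ1 : ρ ≤ 1 := by rw [hρ, div_le_one hMr, hr]; linarith
  have hBρ : ∀ b ∈ B, p' b ≤ ρ * p' a := by
    intro b hb
    have hab : a ≠ b := fun h => haB (h ▸ hb)
    have e1 : p' b = p b / (1 - r) := by simp [hp', hab]
    have e2 : ρ * p' a = (M - t) / (1 - r) := by
      rw [hρ, hM'eq]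
      field_simp
    rw [e1, e2]
    exact div_le_div_of_nonneg_right (hB b hb).le h1r.le
  set Q := sampleProb p' (fun x : Fin n → Y => ∀ b ∈ B, occ x b ≤ occ x a) with hQ
  set W := sampleProb p (fun x : Fin n → Y => ∀ b ∈ B, occ x b < occ x a)
  have hQ0 : 0 ≤ Q := sampleProb_nonneg h0' _
  have hahead := fun k => sampleProb_ahead_le (n := n) h0' h1' haB hρ0 hρ1 hBρ k
  have hrec := fun (k : ℕ) (θ η : ℝ) => mul_sampleProb_le_sampleProb_ahead (n := n) (θ := θ)
    (η := η) hr0.le (by linarith) hpp h0' h1' haB k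
  have hQW : (1 - Real.exp (-(n * t / 4))) * Q ≤ W := by
    -- With `k = 0` and `θ = 0`, the convention `0 ^ 0 = 1` makes the Chernoff bound the probability
    -- of no success at all.
    have := hrec 0 0 (Real.exp (-(n * t / 4))) le_rfl zero_le_one (by simp)
      (Real.exp_pos _).le (by
        rw [pow_zero, one_mul]
        refine Real.exp_le_exp.2 (le_of_eq ?_)
        rw [hr]; ring)
    simpa only [add_zero] using this
  have hnot : ∀ k : ℕ, sampleProb p' (fun x : Fin n → Y => ∀ b ∈ B, occ x b ≤ occ x a + k)
      + sampleProb p' (fun x : Fin n → Y => ∃ b ∈ B, occ x a + k + 1 ≤ occ x b) = 1 := by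
    intro k
    have := sampleProb_add_not (n := n) h1'
      (fun x : Fin n → Y => ∀ b ∈ B, occ x b ≤ occ x a + k)
    push Not at this
    simpa only [Nat.lt_iff_add_one_le] using this
  have hMQ : p' a ≤ Q := by
    have e1 := hahead 0
    have e2 := hnot 0
    simp only [add_zero, pow_zero, one_mul] at e1 e2
    rw [← hQ] at e1 e2
    nlinarith
  have hs0 : 0 < n * t := by positivity
  -- Here `Q ≥ M / 2` and `1 - exp (-x) ≥ x / (1 + x)` suffice: the claim becomes `t * (4 + n * t) ≤
  -- 18 * M`, and `t < M` leaves room for `14 * M`.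
  by_cases hcase : n * t ^ 2 ≤ 14 * M
  · have hE : Real.exp (-(n * t / 4)) ≤ 1 / (1 + n * t / 4) := by
      rw [Real.exp_neg, one_div]
      exact inv_anti₀ (by positivity) (by linarith [Real.add_one_le_exp ((n : ℝ) * t / 4)])
    have hE' : n * t / (4 + n * t) ≤ 1 - Real.exp (-(n * t / 4)) := by
      have : 1 - 1 / (1 + n * t / 4) = n * t / (4 + n * t) := by
        field_simp
        ring
      linarith
    have hQ2 : M / 2 ≤ Q := by rw [hr] at hM'le; linarith
    have : n * t / (4 + n * t) * (M / 2) ≤ W :=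
      le_trans (mul_le_mul hE' hQ2 (by linarith) (le_trans (by positivity) hE')) hQW
    refine le_trans ?_ this
    rw [div_mul_eq_mul_div, le_div_iff₀ (by positivity)]
    have : t * (4 + n * t) ≤ 18 * M := by nlinarith
    nlinarith
  · push Not at hcase
    have hs14 : 14 ≤ n * t := by
      have : 14 * t < n * t * t := by nlinarith
      exact (lt_of_mul_lt_mul_right this ht.le).le
    set k := ⌊(n : ℝ) * t / 8⌋₊ with hk
    have hk1 : (k : ℝ) ≤ n * t / 8 := Nat.floor_le (by positivity)
    have hk2 : n * t / 8 < k + 1 := Nat.lt_floor_add_one _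
    -- If `a` trails by at most `k` half of the time, recolouring wins with probability at least
    -- `1/5 * 1/2 = 1/10`, which covers `n t² / 36`. Otherwise a lead above `k` is common, and the
    -- exchange bound forces `Q` to be about `ρ ^ (-k)` times larger than `p' a / 2`.
    by_cases hhalf : 1 / 2 ≤
        sampleProb p' (fun x : Fin n → Y => ∀ b ∈ B, occ x b ≤ occ x a + k)
    · have hη : (2 : ℝ) ^ k * Real.exp (-(n * t / 8)) ≤ 4 / 5 := by
        have hlog : (2 : ℝ) ^ k = Real.exp (k * Real.log 2) := by
          rw [mul_comm, Real.exp_mul, Real.exp_log (by norm_num), Real.rpow_natCast]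
        rw [hlog, ← Real.exp_add]
        have hl2 := Real.log_two_lt_d9
        have hl2' := Real.log_two_gt_d9
        have : k * Real.log 2 + -(n * t / 8) ≤ -(1 / 2) := by nlinarith
        refine (Real.exp_le_exp.2 this).trans ?_
        rw [Real.exp_neg, inv_le_comm₀ (Real.exp_pos _) (by norm_num)]
        have := Real.add_one_le_exp (1 / 2 : ℝ)
        linarith
      have := hrec k (1 / 2) ((2 : ℝ) ^ k * Real.exp (-(n * t / 8))) (by norm_num) (by norm_num)
        (by positivity) (by positivity) (by
          rw [← mul_assoc, ← mul_pow]
          norm_num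
          rw [hr]
          refine le_of_eq ?_
          ring)
      nlinarith
    · push Not at hhalf
      have hex : 1 / 2 ≤
          sampleProb p' (fun x : Fin n → Y => ∃ b ∈ B, occ x a + k + 1 ≤ occ x b) := by
        linarith [hnot k]
      have e1 : p' a * (1 / 2) ≤ ρ ^ k * Q := by
        refine (mul_le_mul_of_nonneg_left hex (h0' a)).trans ((hahead k).trans ?_)
        refine mul_le_mul_of_nonneg_right ?_ hQ0
        exact mul_le_of_le_one_right (pow_nonneg hρ0 _) (by linarith [h0' a])
      set v := r / (M - t) with hv
      have hv0 : 0 ≤ v := by positivity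
      have hρv : ρ * (1 + v) = 1 := by
        rw [hρ, hv, div_mul_eq_mul_div, div_eq_one_iff_eq hMr.ne', mul_add, mul_div_cancel₀ _ hMt.ne',
          hr]
        ring
      -- Bernoulli's inequality for `ρ⁻¹ = 1 + v`.
      have e2 : ρ ^ k * (1 + k * v) ≤ 1 := by
        have := one_add_mul_le_pow (by linarith : (-2 : ℝ) ≤ v) k
        calc ρ ^ k * (1 + k * v) ≤ ρ ^ k * (1 + v) ^ k :=
              mul_le_mul_of_nonneg_left this (pow_nonneg hρ0 _)
          _ = 1 := by rw [← mul_pow, hρv, one_pow]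
      have hkv : 0 ≤ 1 + k * v := by positivity
      have e3 : p' a * (1 / 2) * (1 + k * v) ≤ Q := by
        calc p' a * (1 / 2) * (1 + k * v) ≤ ρ ^ k * Q * (1 + k * v) :=
              mul_le_mul_of_nonneg_right e1 hkv
          _ = ρ ^ k * (1 + k * v) * Q := by ring
          _ ≤ 1 * Q := mul_le_mul_of_nonneg_right e2 hQ0
          _ = Q := one_mul Q
      have e4 : n * t ^ 2 / 16 ≤ p' a * (1 + k * v) :=
        mul_sq_div_le_mul_one_add ht htM hM'le (Nat.cast_nonneg k) hk2.le
      have hE : Real.exp (-(n * t / 4)) ≤ 1 / 9 := by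
        have h3 : (9 : ℝ) ≤ Real.exp (n * t / 4) := by
          have : Real.exp 1 ^ 3 ≤ Real.exp (n * t / 4) := by
            rw [← Real.exp_nat_mul]
            exact Real.exp_le_exp.2 (by push_cast; linarith)
          have h27 : (2.7 : ℝ) ≤ Real.exp 1 := by linarith [Real.exp_one_gt_d9]
          have := pow_le_pow_left₀ (by norm_num) h27 3
          have h9 : (9 : ℝ) ≤ 2.7 ^ 3 := by norm_num
          linarith
        rw [Real.exp_neg, inv_le_comm₀ (Real.exp_pos _) (by norm_num)]
        linarith
      have hQ32 : n * t ^ 2 / 32 ≤ Q := by linarith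
      have : 8 / 9 * Q ≤ W := le_trans (mul_le_mul_of_nonneg_right (by linarith) hQ0) hQW
      linarith

end Recolouring

/-! ### Hoeffding's lemma, McDiarmid's inequality and second moments. -/

section BoundedDifferences

variable {Y : Type*} [Fintype Y] {n : ℕ}

/-- The expectation of `f` under an independent sample with mass function `p`. -/
noncomputable def sampleMean (p : Y → ℝ) (f : (Fin n → Y) → ℝ) : ℝ :=
  ∑ x : Fin n → Y, (∏ i, p (x i)) * f x

lemma sampleMean_mono {p : Y → ℝ} (h0 : ∀ y, 0 ≤ p y) {f g : (Fin n → Y) → ℝ}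
    (h : ∀ x, f x ≤ g x) : sampleMean p f ≤ sampleMean p g :=
  Finset.sum_le_sum fun x _ =>
    mul_le_mul_of_nonneg_left (h x) (Finset.prod_nonneg fun _ _ => h0 _)

lemma sampleMean_add (p : Y → ℝ) (f g : (Fin n → Y) → ℝ) :
    sampleMean p (fun x => f x + g x) = sampleMean p f + sampleMean p g := by
  simp only [sampleMean, mul_add, Finset.sum_add_distrib]

lemma sampleMean_const_mul (p : Y → ℝ) (c : ℝ) (f : (Fin n → Y) → ℝ) :
    sampleMean p (fun x => c * f x) = c * sampleMean p f := by
  simp only [sampleMean, Finset.mul_sum]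
  exact Finset.sum_congr rfl fun _ _ => by ring

lemma sampleMean_const {p : Y → ℝ} (h1 : ∑ y, p y = 1) (c : ℝ) :
    sampleMean p (fun _ : Fin n → Y => c) = c := by
  rw [sampleMean, ← Finset.sum_mul, sum_prod_eq_one h1, one_mul]

lemma sampleMean_succ (p : Y → ℝ) (f : (Fin (n + 1) → Y) → ℝ) :
    sampleMean p f = ∑ y, p y * sampleMean p (fun x : Fin n → Y => f (Fin.cons y x)) := by
  unfold sampleMean
  rw [← Equiv.sum_comp (Fin.consEquiv fun _ => Y), Fintype.sum_prod_type]
  refine Finset.sum_congr rfl fun y _ => ?_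
  rw [Finset.mul_sum]
  refine Finset.sum_congr rfl fun x _ => ?_
  simp only [Fin.consEquiv, Equiv.coe_fn_mk]
  rw [Fin.prod_univ_succ]
  simp only [Fin.cons_zero, Fin.cons_succ]
  ring

/-- Hoeffding's lemma for a mass function on a finite type. -/
lemma sum_mul_exp_le {p : Y → ℝ} (h0 : ∀ y, 0 ≤ p y) (h1 : ∑ y, p y = 1) {h : Y → ℝ} {c : ℝ}
    (hc : ∀ y z, h y - h z ≤ c) (l : ℝ) :
    ∑ y, p y * Real.exp (l * (h y - ∑ z, p z * h z)) ≤ Real.exp (l ^ 2 * c ^ 2 / 8) := by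
  classical
  have hne : Nonempty Y := by
    by_contra hY
    rw [not_nonempty_iff] at hY
    simp at h1
  let _ : MeasurableSpace Y := ⊤
  let P : PMF Y := PMF.ofFintype (fun y => ENNReal.ofReal (p y)) (by
    rw [← ENNReal.ofReal_sum_of_nonneg fun y _ => h0 y, h1, ENNReal.ofReal_one])
  have hP : ∀ y, (P y).toReal = p y := fun y => by
    simp [P, ENNReal.toReal_ofReal (h0 y)]
  have hint : ∀ f : Y → ℝ, ∫ y, f y ∂P.toMeasure = ∑ y, p y * f y := fun f => by
    rw [PMF.integral_eq_sum]
    simp [hP]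
  obtain ⟨y₀, -, hy₀⟩ := Finset.exists_min_image Finset.univ h Finset.univ_nonempty
  have hsub := hasSubgaussianMGF_of_mem_Icc (μ := P.toMeasure) (X := h) (a := h y₀)
    (b := h y₀ + c) (by exact (measurable_of_finite h).aemeasurable)
    (Filter.Eventually.of_forall fun y => ⟨hy₀ y (Finset.mem_univ y), by linarith [hc y y₀]⟩)
  have := hsub.mgf_le l
  rw [mgf, hint, hint] at this
  refine this.trans (le_of_eq ?_)
  congr 1
  simp only [add_sub_cancel_left, NNReal.coe_pow, NNReal.coe_div, coe_nnnorm, NNReal.coe_ofNat,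
    Real.norm_eq_abs, div_pow, sq_abs]
  ring

/-- The moment generating function bound behind McDiarmid's inequality. -/
lemma sampleMean_exp_le {p : Y → ℝ} (h0 : ∀ y, 0 ≤ p y) (h1 : ∑ y, p y = 1) {c : ℝ} (l : ℝ) :
    ∀ {n : ℕ} (f : (Fin n → Y) → ℝ), (∀ x i y, f x - f (Function.update x i y) ≤ c) →
      sampleMean p (fun x => Real.exp (l * (f x - sampleMean p f)))
        ≤ Real.exp (n * (l ^ 2 * c ^ 2 / 8)) := by
  classical
  intro n
  induction n with
  | zero =>
    intro f _
    simp [sampleMean, Subsingleton.elim _ (default : Fin 0 → Y)]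
  | succ n ih =>
    intro f hf
    -- The conditional mean given the first entry inherits the oscillation bound `c`: Hoeffding's
    -- lemma handles it, the induction hypothesis the remaining entries.
    set h : Y → ℝ := fun y => sampleMean p (fun x : Fin n → Y => f (Fin.cons y x)) with hh
    have hmean : sampleMean p f = ∑ y, p y * h y := sampleMean_succ p f
    have hdiff : ∀ y z, h y - h z ≤ c := by
      intro y z
      have : h y ≤ sampleMean p (fun x : Fin n → Y => f (Fin.cons z x) + c) := by
        refine sampleMean_mono h0 fun x => ?_
        have := hf (Fin.cons y x) 0 z
        rw [Fin.update_cons_zero] at this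
        linarith
      rw [sampleMean_add, sampleMean_const h1] at this
      rw [hh] at this ⊢
      linarith
    have hstep : ∀ y, sampleMean p (fun x : Fin n → Y =>
        Real.exp (l * (f (Fin.cons y x) - sampleMean p f)))
        ≤ Real.exp (l * (h y - ∑ z, p z * h z)) * Real.exp (n * (l ^ 2 * c ^ 2 / 8)) := by
      intro y
      have := ih (fun x : Fin n → Y => f (Fin.cons y x)) (fun x i z => by
        have := hf (Fin.cons y x) i.succ z
        rwa [← Fin.cons_update] at this)
      refine le_trans (le_of_eq ?_) (mul_le_mul_of_nonneg_left this (Real.exp_pos _).le)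
      rw [← sampleMean_const_mul]
      congr 1
      ext x
      rw [← Real.exp_add, hmean]
      congr 1
      simp only [hh]
      ring
    rw [sampleMean_succ]
    calc ∑ y, p y * sampleMean p (fun x : Fin n → Y =>
          Real.exp (l * (f (Fin.cons y x) - sampleMean p f)))
        ≤ ∑ y, p y * (Real.exp (l * (h y - ∑ z, p z * h z))
            * Real.exp (n * (l ^ 2 * c ^ 2 / 8))) :=
          Finset.sum_le_sum fun y _ => mul_le_mul_of_nonneg_left (hstep y) (h0 y)
      _ = (∑ y, p y * Real.exp (l * (h y - ∑ z, p z * h z)))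
            * Real.exp (n * (l ^ 2 * c ^ 2 / 8)) := by
          rw [Finset.sum_mul]
          exact Finset.sum_congr rfl fun _ _ => by ring
      _ ≤ Real.exp (l ^ 2 * c ^ 2 / 8) * Real.exp (n * (l ^ 2 * c ^ 2 / 8)) :=
          mul_le_mul_of_nonneg_right (sum_mul_exp_le h0 h1 hdiff l) (Real.exp_pos _).le
      _ = Real.exp ((n + 1 : ℕ) * (l ^ 2 * c ^ 2 / 8)) := by
          rw [← Real.exp_add]
          congr 1
          push_cast
          ring

/-- **McDiarmid's inequality** for a sample from a finite type. -/
lemma sampleProb_mean_add_le {p : Y → ℝ} (h0 : ∀ y, 0 ≤ p y) (h1 : ∑ y, p y = 1) {c s : ℝ}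
    (hn : 0 < n) (hc : 0 < c) (hs : 0 ≤ s) (f : (Fin n → Y) → ℝ)
    (hf : ∀ x i y, f x - f (Function.update x i y) ≤ c) :
    sampleProb p (fun x => sampleMean p f + s ≤ f x) ≤ Real.exp (-(2 * s ^ 2 / (n * c ^ 2))) := by
  classical
  have hn0 : (0 : ℝ) < n := by exact_mod_cast hn
  -- The minimiser of `n * l ^ 2 * c ^ 2 / 8 - l * s`.
  set l := 4 * s / (n * c ^ 2) with hl
  have hl0 : 0 ≤ l := by positivity
  have hle : sampleProb p (fun x => sampleMean p f + s ≤ f x)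
      ≤ sampleMean p (fun x => Real.exp (-(l * s)) * Real.exp (l * (f x - sampleMean p f))) := by
    refine Finset.sum_le_sum fun x _ => ?_
    have hw : 0 ≤ ∏ i, p (x i) := Finset.prod_nonneg fun _ _ => h0 _
    simp only [← Real.exp_add]
    split_ifs with hx
    · refine le_mul_of_one_le_right hw (Real.one_le_exp ?_)
      nlinarith
    · exact mul_nonneg hw (Real.exp_pos _).le
  rw [sampleMean_const_mul] at hle
  refine hle.trans ((mul_le_mul_of_nonneg_left (sampleMean_exp_le h0 h1 l f hf)
    (Real.exp_pos _).le).trans (le_of_eq ?_))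
  rw [← Real.exp_add]
  congr 1
  rw [hl]
  field_simp
  ring

lemma sampleMean_sum_eq_zero {p : Y → ℝ} (h1 : ∑ y, p y = 1) {f : Y → ℝ}
    (hf : ∑ y, p y * f y = 0) : ∀ n : ℕ, sampleMean p (fun x : Fin n → Y => ∑ i, f (x i)) = 0 := by
  intro n
  induction n with
  | zero => simp [sampleMean]
  | succ n ih =>
    rw [sampleMean_succ]
    simp only [Fin.sum_univ_succ, Fin.cons_zero, Fin.cons_succ]
    simp only [sampleMean_add, sampleMean_const h1, ih, add_zero, hf]

/-- The variance of a sum of centred independent variables. -/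
lemma sampleMean_sum_sq {p : Y → ℝ} (h1 : ∑ y, p y = 1) {f : Y → ℝ} (hf : ∑ y, p y * f y = 0) :
    ∀ n : ℕ, sampleMean p (fun x : Fin n → Y => (∑ i, f (x i)) ^ 2) = n * ∑ y, p y * f y ^ 2 := by
  intro n
  induction n with
  | zero => simp [sampleMean]
  | succ n ih =>
    rw [sampleMean_succ]
    simp only [Fin.sum_univ_succ, Fin.cons_zero, Fin.cons_succ]
    have : ∀ y, sampleMean p (fun x : Fin n → Y => (f y + ∑ i, f (x i)) ^ 2)
        = f y ^ 2 + n * ∑ y, p y * f y ^ 2 := by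
      intro y
      have e : (fun x : Fin n → Y => (f y + ∑ i, f (x i)) ^ 2)
          = fun x => f y ^ 2 + (2 * f y * ∑ i, f (x i) + (∑ i, f (x i)) ^ 2) := by
        ext x; ring
      rw [e, sampleMean_add, sampleMean_add, sampleMean_const h1, sampleMean_const_mul,
        sampleMean_sum_eq_zero h1 hf, ih]
      ring
    simp only [this, mul_add, Finset.sum_add_distrib, ← Finset.sum_mul, h1]
    push_cast
    ring

lemma sampleMean_sq_le {p : Y → ℝ} (h0 : ∀ y, 0 ≤ p y) (h1 : ∑ y, p y = 1)
    (f : (Fin n → Y) → ℝ) : sampleMean p f ^ 2 ≤ sampleMean p (fun x => f x ^ 2) := by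
  set m := sampleMean p f with hm
  have h : 0 ≤ sampleMean p (fun x => (f x - m) ^ 2) := by
    rw [← sampleMean_const (n := n) h1 0]
    exact sampleMean_mono h0 fun x => sq_nonneg _
  have e : (fun x : Fin n → Y => (f x - m) ^ 2)
      = fun x => f x ^ 2 + ((-2 * m) * f x + m ^ 2) := by
    ext x; ring
  rw [e, sampleMean_add, sampleMean_add, sampleMean_const h1, sampleMean_const_mul, ← hm] at h
  linarith

end BoundedDifferences

/-! ### The norm of the count deviations, and the bound for one distribution. -/

section Deviation

variable {Y : Type*} [DecidableEq Y] {n : ℕ}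

/-- The vector of deviations of the counts of a sample from their means. -/
noncomputable def deviation (p : Y → ℝ) (x : Fin n → Y) : EuclideanSpace ℝ Y :=
  WithLp.toLp 2 fun y => ∑ i, ((if x i = y then 1 else 0) - p y)

lemma deviation_apply (p : Y → ℝ) (x : Fin n → Y) (y : Y) :
    deviation p x y = occ x y - n * p y := by
  simp [deviation, occ]

variable [Fintype Y]

/-- Changing one entry moves at most two counts, each by one. -/
lemma norm_deviation_sub_update_le (p : Y → ℝ) (x : Fin n → Y) (i : Fin n) (z : Y) :
    ‖deviation p x‖ - ‖deviation p (Function.update x i z)‖ ≤ √2 := by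
  refine (norm_sub_norm_le _ _).trans ?_
  rw [EuclideanSpace.norm_eq]
  refine Real.sqrt_le_sqrt ?_
  have h : ∀ y, ‖(deviation p x - deviation p (Function.update x i z)) y‖ ^ 2
      ≤ (if x i = y then 1 else 0) + if z = y then 1 else 0 := by
    intro y
    have e : (deviation p x - deviation p (Function.update x i z)) y
        = (if x i = y then 1 else 0) - if z = y then 1 else 0 := by
      simp only [deviation, PiLp.sub_apply]
      rw [← Finset.sum_sub_distrib, Finset.sum_eq_single i]
      · simp
      · intro j _ hj
        simp [Function.update_of_ne hj]
      · simp
    rw [e, Real.norm_eq_abs, sq_abs]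
    split_ifs <;> norm_num
  refine (Finset.sum_le_sum fun y _ => h y).trans ?_
  rw [Finset.sum_add_distrib]
  simp
  norm_num

/-- The count variances `n * (p y - p y ^ 2)` sum to at most `n`, independently of the size of `Y`.
-/
lemma sampleMean_norm_deviation_le {p : Y → ℝ} (h0 : ∀ y, 0 ≤ p y) (h1 : ∑ y, p y = 1) :
    sampleMean p (fun x : Fin n → Y => ‖deviation p x‖) ≤ √n := by
  refine Real.le_sqrt_of_sq_le ((sampleMean_sq_le h0 h1 _).trans ?_)
  have e : (fun x : Fin n → Y => ‖deviation p x‖ ^ 2)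
      = fun x => ∑ y, (∑ i, ((if x i = y then 1 else 0) - p y)) ^ 2 := by
    ext x
    rw [EuclideanSpace.norm_sq_eq]
    simp [deviation]
  have hsum : sampleMean p (fun x : Fin n → Y => ∑ y, (∑ i, ((if x i = y then 1 else 0) - p y)) ^ 2)
      = ∑ y, sampleMean p (fun x : Fin n → Y => (∑ i, ((if x i = y then 1 else 0) - p y)) ^ 2) := by
    simp only [sampleMean, Finset.mul_sum]
    exact Finset.sum_comm
  rw [e, hsum]
  have hy : ∀ y, sampleMean p (fun x : Fin n → Y => (∑ i, ((if x i = y then 1 else 0) - p y)) ^ 2)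
      ≤ n * p y := by
    intro y
    have hc : ∑ z, p z * ((if z = y then 1 else 0) - p y) = 0 := by
      simp [mul_sub, Finset.sum_sub_distrib, ← Finset.sum_mul, h1]
    have := sampleMean_sum_sq h1 hc n
    refine this.le.trans (mul_le_mul_of_nonneg_left ?_ (Nat.cast_nonneg n))
    have e2 : ∑ z, p z * ((if z = y then 1 else 0) - p y) ^ 2 = p y - p y ^ 2 := by
      have e3 : ∀ z, p z * ((if z = y then 1 else 0) - p y) ^ 2
          = (if z = y then p z * (1 - 2 * p y) else 0) + p z * p y ^ 2 := by
        intro z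
        split_ifs <;> ring
      simp only [e3, Finset.sum_add_distrib, ← Finset.sum_mul, h1]
      simp
      ring
    rw [e2]
    nlinarith [sq_nonneg (p y)]
  refine (Finset.sum_le_sum fun y _ => hy y).trans ?_
  rw [← Finset.mul_sum, h1, mul_one]

/-- The expected gap is at most the shortfall of `a` plus the excess of `b`; then `(u + v)² ≤ 2 (u²
+ v²)`. -/
lemma sub_le_norm_deviation (p : Y → ℝ) (x : Fin n → Y) {a b : Y} (hab : a ≠ b)
    (hx : occ x a ≤ occ x b) : n * p a - n * p b ≤ √2 * ‖deviation p x‖ := by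
  have h : deviation p x a ^ 2 + deviation p x b ^ 2 ≤ ‖deviation p x‖ ^ 2 := by
    rw [EuclideanSpace.norm_sq_eq, ← Finset.sum_pair
      (f := fun y => (deviation p x) y ^ 2) hab]
    refine (Finset.sum_le_sum_of_subset_of_nonneg (Finset.subset_univ _)
      fun y _ _ => sq_nonneg _).trans (le_of_eq ?_)
    simp
  rw [deviation_apply, deviation_apply] at h
  have hx' : (occ x a : ℝ) ≤ occ x b := by exact_mod_cast hx
  refine le_trans (b := ((n * p a - occ x a) + (occ x b - n * p b))) (by linarith) ?_
  refine abs_le_of_sq_le_sq' ?_ (by positivity) |>.2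
  rw [mul_pow, Real.sq_sqrt (by norm_num)]
  nlinarith [sq_nonneg ((n * p a - occ x a) - (occ x b - n * p b))]

/-- With probability at least `1 - exp (-L)`, no outcome that is less likely than `a` by more than
`6 √(L / n)` occurs at least as often as `a` in a sample of size `n`. -/
theorem one_sub_exp_neg_le_sampleProb {p : Y → ℝ} (h0 : ∀ y, 0 ≤ p y) (h1 : ∑ y, p y = 1) {a : Y}
    (hn : 0 < n) {L : ℝ} (hL : 0 < L) :
    1 - Real.exp (-L) ≤ sampleProb p (fun x : Fin n → Y =>
      ∀ b, occ x a ≤ occ x b → p a - p b ≤ 6 * √(1 / n * L)) := by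
  classical
  have hn0 : (0 : ℝ) < n := by exact_mod_cast hn
  set t := 6 * √(1 / n * L) with ht
  have ht0 : 0 < t := by positivity
  have ht2 : n * t ^ 2 = 36 * L := by
    rw [ht, mul_pow, Real.sq_sqrt (by positivity)]
    field_simp
    norm_num
  rcases le_total L (1 / 10) with hsmall | hlarge
  · have h := le_sampleProb_ahead (n := n) (a := a) (B := Finset.univ.filter fun b => p b < p a - t)
      h0 h1 hn ht0 (by simp) (by linarith)
    refine le_trans ?_ (h.trans (sampleProb_mono h0 ?_))
    · rw [ht2]
      linarith [Real.one_sub_le_exp_neg L]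
    · intro x hx b hab
      by_contra! hb
      have := hx b (by simp; linarith)
      omega
  · have hmc := sampleProb_mean_add_le h0 h1 hn (c := √2) (s := √(n * L)) (by positivity)
      (by positivity) (fun x : Fin n → Y => ‖deviation p x‖) (norm_deviation_sub_update_le p)
    rw [Real.sq_sqrt (by positivity), Real.sq_sqrt (by norm_num)] at hmc
    have e : -(2 * (n * L) / (n * 2)) = -L := by field_simp
    rw [e] at hmc
    have hadd := sampleProb_add_not (n := n) h1 (fun x : Fin n → Y =>
      sampleMean p (fun x : Fin n → Y => ‖deviation p x‖) + √(n * L) ≤ ‖deviation p x‖)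
    refine le_trans (by linarith) (sampleProb_mono h0 (S := fun x : Fin n → Y =>
      ¬ sampleMean p (fun x : Fin n → Y => ‖deviation p x‖) + √(n * L) ≤ ‖deviation p x‖) ?_)
    intro x hx b hab
    by_contra! hb
    refine hx ?_
    have hne : a ≠ b := by
      rintro rfl
      linarith
    have hdev := sub_le_norm_deviation p x hne hab
    have hmean := sampleMean_norm_deviation_le (n := n) h0 h1
    have hnt : n * t = 6 * √(n * L) := by
      have : √(1 / n * L) = √(n * L) / n := by
        rw [Real.sqrt_eq_iff_mul_self_eq (by positivity) (by positivity), div_mul_div_comm,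
          Real.mul_self_sqrt (by positivity)]
        field_simp
      rw [ht, this]
      field_simp
    -- `L ≥ 1/10` enters here; a violation would give `6 < 1.4144 * (1 + 3.17)`, about 5.9.
    have hroot : √n ≤ 3.17 * √(n * L) := by
      rw [Real.sqrt_mul hn0.le]
      have : 1 ≤ 3.17 * √L := by
        have h3 : (0.3155 : ℝ) ≤ √L := Real.le_sqrt_of_sq_le (by norm_num at hlarge ⊢; linarith)
        linarith
      nlinarith [Real.sqrt_nonneg (n : ℝ)]
    have h2 : √2 ≤ 1.4144 := Real.sqrt_le_iff.2 ⟨by norm_num, by norm_num⟩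
    have hlt : 6 * √(n * L) ≤ √2 * ‖deviation p x‖ := by
      rw [← hnt]
      nlinarith
    have : 6 * √(n * L) ≤ 1.4144 * ‖deviation p x‖ :=
      hlt.trans (mul_le_mul_of_nonneg_right h2 (norm_nonneg _))
    linarith [Real.sqrt_nonneg (n * L)]

end Deviation

/-! ### From counts to regret: the sample law and the Wasserstein bound. -/

section Regret

variable {Y : Type*}

lemma mass_nonneg (P : PMF Y) (y : Y) : 0 ≤ mass P y := ENNReal.toReal_nonneg

lemma empirical_eq_occ_div [DecidableEq Y] {n : ℕ} (s : Fin n → Y) (y : Y) : empirical s y = occ s y / n := by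
  simp [empirical, indicatorUtility, occ, eq_comm]

/-- A Monte Carlo MAP output is at least as frequent as any hypothesis, sampled or not. -/
lemma IsMonteCarloMAP.occ_le [DecidableEq Y] {n : ℕ} (hn : 0 < n) {s : Fin n → Y} {y : Y}
    (hy : IsMonteCarloMAP s y) (z : Y) : occ s z ≤ occ s y := by
  have hn0 : (0 : ℝ) < n := by exact_mod_cast hn
  by_cases hz : ∃ i, s i = z
  · obtain ⟨i, rfl⟩ := hz
    have := hy.2 i
    rw [empirical_eq_occ_div, empirical_eq_occ_div, div_le_div_iff_of_pos_right hn0] at this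
    exact_mod_cast this
  · push Not at hz
    have : occ s z = 0 := by simp [occ, hz]
    omega

variable [Fintype Y]

lemma sum_mass (P : PMF Y) : ∑ y, mass P y = 1 := by
  unfold mass
  rw [← ENNReal.toReal_sum fun y _ => P.apply_ne_top y, ← tsum_fintype (L := .unconditional Y), P.tsum_coe,
    ENNReal.toReal_one]

lemma isCoupling_mul (ν μ : PMF Y) : IsCoupling ν μ fun i j => mass ν i * mass μ j where
  nonneg i j := mul_nonneg (mass_nonneg ν i) (mass_nonneg μ j)
  marginal_fst i := by rw [← Finset.mul_sum, sum_mass, mul_one]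
  marginal_snd j := by rw [← Finset.sum_mul, sum_mass, one_mul]

/-- The law of an i.i.d. sample. -/
lemma measureReal_sample_eq_sampleProb [MeasurableSpace Y] [MeasurableSingletonClass Y]
    (P : PMF Y) {Ω : Type*} [MeasurableSpace Ω] (μ : Measure Ω) [IsProbabilityMeasure μ]
    {n : ℕ} (X : Fin n → Ω → Y) (hXmeas : ∀ i, Measurable (X i)) (hXindep : iIndepFun X μ)
    (hXlaw : ∀ i, Measure.map (X i) μ = P.toMeasure) (S : (Fin n → Y) → Prop) :
    μ.real {ω | S fun i => X i ω} = sampleProb (mass P) S := by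
  classical
  have hmap := (iIndepFun_iff_map_fun_eq_pi_map fun i => (hXmeas i).aemeasurable).1 hXindep
  simp only [hXlaw] at hmap
  have hm : Measurable fun ω i => X i ω := measurable_pi_lambda _ hXmeas
  have hS : MeasurableSet {x : Fin n → Y | S x} := (Set.toFinite _).measurableSet
  have h1 : μ.real {ω | S fun i => X i ω}
      = (Measure.pi fun _ : Fin n => P.toMeasure).real {x | S x} := by
    rw [← hmap, map_measureReal_apply hm hS]
    rfl
  have h2 : {x : Fin n → Y | S x}
      = ((Finset.univ.filter fun x => S x : Finset (Fin n → Y)) : Set (Fin n → Y)) := by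
    ext x; simp
  rw [h1, h2, ← sum_measureReal_singleton, sampleProb, Finset.sum_filter]
  refine Finset.sum_congr rfl fun x _ => ?_
  congr 1
  rw [measureReal_def, Measure.pi_singleton, ENNReal.toReal_prod]
  refine Finset.prod_congr rfl fun i _ => ?_
  rw [P.toMeasure_apply_singleton _ (measurableSet_singleton _), mass]

variable [DecidableEq Y]

/-- Two distributions differ at each point by at most their Wasserstein distance, if the indicator
utility is smooth with respect to the cost. -/
lemma abs_mass_sub_mass_le_WD {C : Y → Y → ℝ} (hC : UtilitySmooth indicatorUtility C)
    (ν μ : PMF Y) (y : Y) : |mass ν y - mass μ y| ≤ WD C ν μ := by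
  -- The product coupling shows that the infimum is over a nonempty set; the real `sInf ∅` would be
  -- `0`.
  refine le_csInf ⟨_, _, isCoupling_mul ν μ, rfl⟩ ?_
  rintro c ⟨γ, hγ, rfl⟩
  have e1 : mass ν y = ∑ i, ∑ j, γ i j * indicatorUtility y i := by
    simp [indicatorUtility, hγ.marginal_fst]
  have e2 : mass μ y = ∑ i, ∑ j, γ i j * indicatorUtility y j := by
    rw [Finset.sum_comm]
    simp [indicatorUtility, hγ.marginal_snd]
  rw [e1, e2, ← Finset.sum_sub_distrib]
  refine (Finset.abs_sum_le_sum_abs _ _).trans (Finset.sum_le_sum fun i _ => ?_)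
  rw [← Finset.sum_sub_distrib]
  refine (Finset.abs_sum_le_sum_abs _ _).trans (Finset.sum_le_sum fun j _ => ?_)
  rw [← mul_sub, abs_mul, abs_of_nonneg (hγ.nonneg i j)]
  exact mul_le_mul_of_nonneg_left (hC y i j) (hγ.nonneg i j)

end Regret

end MAPDecoding

theorem theorem3
    {Y : Type*} [Fintype Y] [DecidableEq Y] [MeasurableSpace Y] [MeasurableSingletonClass Y]
    (Phuman Pmodel : PMF Y) (C : Y → Y → ℝ)
    (hC : MAPDecoding.UtilitySmooth MAPDecoding.indicatorUtility C)
    {Ω : Type*} [MeasurableSpace Ω] (μ : Measure Ω) [IsProbabilityMeasure μ]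
    (n : ℕ) (hn : 0 < n) (X : Fin n → Ω → Y)
    (hXmeas : ∀ i, Measurable (X i))
    (hXindep : iIndepFun X μ)
    (hXlaw : ∀ i, Measure.map (X i) μ = Pmodel.toMeasure)
    (yStar : Y) (hyStar : MAPDecoding.IsMAP Phuman yStar)
    (yHat : Ω → Y) (hyHatmeas : Measurable yHat)
    (hyHat : ∀ ω, MAPDecoding.IsMonteCarloMAP (fun i => X i ω) (yHat ω))
    (δ : ℝ) (hδ0 : 0 < δ) (hδ1 : δ < 1) :
    1 - δ ≤ μ.real {ω | MAPDecoding.mapRegret Phuman yStar (yHat ω) ≤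
      6 * √((1 / (n : ℝ)) * Real.log (1 / δ)) + 2 * MAPDecoding.WD C Phuman Pmodel} := by
  open MAPDecoding in
  have hL : 0 < Real.log (1 / δ) := Real.log_pos (by rw [lt_div_iff₀ hδ0]; linarith)
  have hexp : Real.exp (-Real.log (1 / δ)) = δ := by
    rw [one_div, Real.log_inv, neg_neg, Real.exp_log hδ0]
  have h := one_sub_exp_neg_le_sampleProb (mass_nonneg Pmodel) (sum_mass Pmodel) (a := yStar) hn hL
  rw [hexp, ← measureReal_sample_eq_sampleProb Pmodel μ X hXmeas hXindep hXlaw] at h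
  refine h.trans (measureReal_mono fun ω hω => ?_)
  have h1 := hω (yHat ω) ((hyHat ω).occ_le hn yStar)
  have h2 := (abs_le.1 (abs_mass_sub_mass_le_WD hC Phuman Pmodel yStar)).2
  have h3 := (abs_le.1 (abs_mass_sub_mass_le_WD hC Phuman Pmodel (yHat ω))).1
  simp only [Set.mem_ofPred_eq, mapRegret]
  linarith
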